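/- Let $\Omega$ be a nonempty set (the states), $\mathbb K$ a nonempty set of maps $z:\mathbb R_{\ge 0}\to\Omega$ (the processes) such that $z(k+t)=z(k)$ for all $z\in\mathbb K$, $k\in\{0,1,2,\dots\}$, $t\in(0,1)$ (i.e. the processes are discrete-time processes), and let $g:\Omega\to[0,1]$ be a running cost. Let $\mathcal A$ be a $\sigma$-algebra on $\mathbb K$ and let $\mathfrak C$ be the set of all bounded $\mathcal A$-measurable maps $c:\mathbb K\to\mathbb R$. For every $\omega\in\Omega$ let nonempty sets $\mathcal L(\omega)$ and $\mathcal M(\omega)$ be given, and for every $(l,m)\in\mathcal L(\omega)\times\mathcal M(\omega)$ let $\mathbb P^\omega_{lm}$ be a probability measure on $(\mathbb K,\mathcal A)$, with expectation $\mathbb E^\omega_{lm}$. For $c\in\mathfrak C$ put $$W[c](\omega)=\sup_{l\in\mathcal L(\omega)}\ \inf_{m\in\mathcal M(\omega)}\mathbb E^\omega_{lm}c\qquad(\omega\in\Omega).$$ For $n\in\mathbb N=\{1,2,\dots\}$, $\mu\in(0,1)$ and $z\in\mathbb K$ put $$\bar v_n(z)=\frac1n\sum_{t=0}^{n-1}g(z(t)),\qquad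 \bar w_\mu(z)=\mu\sum_{t=0}^\infty(1-\mu)^t g(z(t)),$$ and assume that all $\bar v_n$ and $\bar w_\mu$ are $\mathcal A$-measurable. Assume that both families satisfy the Dynamic Programming Principle, that is: for all $n,h\in\mathbb N$ the payoff $$z\mapsto \frac1{n+h}\sum_{t=0}^{h-1}g(z(t))+\frac n{n+h}\,W[\bar v_n](z(h))$$ lies in $\mathfrak C$ and its image under $W$ equals $W[\bar v_{n+h}]$; and for all $\mu\in(0,1)$, $h\in\mathbb N$ the payoff $$z\mapsto \mu\sum_{t=0}^{h-1}(1-\mu)^t g(z(t))+(1-\mu)^h\,W[\bar w_\mu](z(h))$$ lies in $\mathfrak C$ and its image under $W$ equals $W[\bar w_\mu]$. Then the following two statements are equivalent: (i) the functions $W[\bar v_n]$ converge uniformly on $\Omega$ as $n\to\infty$; (ii) the functions $W[\bar w_\mu]$ converge uniformly on $\Omega$ as $\mu\downarrow0$. Moreover, if at least one of them holds, then $$\lim_{n\to\infty}W[\bar v_n](\omega)=\lim_{\mu\downarrow0}W[\bar w_\mu](\omega)\qquad\text{for all }\omega\in\Omega.$$ -/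

import Mathlib

open Filter Topology MeasureTheory
open scoped NNReal

namespace TauberianGame

noncomputable section

/-- The processes of `K` are discrete-time processes, extended to `ℝ₊` by being constant on each
`[k, k + 1)`. -/
def IsDiscreteTime {Ω : Type*} (K : Set (ℝ≥0 → Ω)) : Prop :=
  ∀ z ∈ K, ∀ (k : ℕ) (t : ℝ≥0), 0 < t → t < 1 → z ((k : ℝ≥0) + t) = z (k : ℝ≥0)

/-- The `n`-stage average payoff `z ↦ (1/n) ∑_{t<n} g(z(t))`. -/
def averagePayoff {Ω : Type*} {K : Set (ℝ≥0 → Ω)} (g : Ω → ℝ) (n : ℕ) (z : K) : ℝ :=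
  (1 / (n : ℝ)) * ∑ t ∈ Finset.range n, g (z.1 (t : ℝ≥0))

/-- The `μ`-discounted payoff `z ↦ μ ∑_{t≥0} (1-μ)^t g(z(t))`. -/
def discountedPayoff {Ω : Type*} {K : Set (ℝ≥0 → Ω)} (g : Ω → ℝ) (μ : ℝ) (z : K) : ℝ :=
  μ * ∑' t : ℕ, (1 - μ) ^ t * g (z.1 (t : ℝ≥0))

/-- The bounded measurable payoffs on the measurable space `K`. -/
def boundedMeasurablePayoffs {Ω : Type*} (K : Set (ℝ≥0 → Ω)) [MeasurableSpace K] :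
    Set (K → ℝ) :=
  {c | Measurable c ∧ ∃ R : ℝ, ∀ z, |c z| ≤ R}

/-- The lower value `ω ↦ sup_l inf_m E^ω_{lm} c`, meaningful for bounded measurable `c`. -/
def lowerValue {Ω : Type*} {K : Set (ℝ≥0 → Ω)} [MeasurableSpace K] {L M : Ω → Type*}
    (P : ∀ ω, L ω → M ω → ProbabilityMeasure K) (c : K → ℝ) (ω : Ω) : ℝ :=
  ⨆ l : L ω, ⨅ m : M ω, ∫ z, c z ∂(P ω l m : Measure K)

/-- The Dynamic Programming Principle for the average payoffs, for a map `V` assigning value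
functions to the payoffs in `C`. -/
def AverageDPP {Ω : Type*} {K : Set (ℝ≥0 → Ω)} (g : Ω → ℝ) (C : Set (K → ℝ))
    (V : (K → ℝ) → Ω → ℝ) : Prop :=
  ∀ n h : ℕ, 1 ≤ n → 1 ≤ h →
    let c : K → ℝ := fun z =>
      (1 / ((n : ℝ) + h)) * ∑ t ∈ Finset.range h, g (z.1 (t : ℝ≥0))
        + ((n : ℝ) / ((n : ℝ) + h)) * V (averagePayoff g n) (z.1 (h : ℝ≥0))
    c ∈ C ∧ V c = V (averagePayoff g (n + h))

/-- The Dynamic Programming Principle for the discounted payoffs, for a map `V` assigning value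
functions to the payoffs in `C`. -/
def DiscountedDPP {Ω : Type*} {K : Set (ℝ≥0 → Ω)} (g : Ω → ℝ) (C : Set (K → ℝ))
    (V : (K → ℝ) → Ω → ℝ) : Prop :=
  ∀ μ : ℝ, 0 < μ → μ < 1 → ∀ h : ℕ, 1 ≤ h →
    let c : K → ℝ := fun z =>
      μ * ∑ t ∈ Finset.range h, (1 - μ) ^ t * g (z.1 (t : ℝ≥0))
        + (1 - μ) ^ h * V (discountedPayoff g μ) (z.1 (h : ℝ≥0))
    c ∈ C ∧ V c = V (discountedPayoff g μ)

end

end TauberianGame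

namespace TauberianGame

/-! ### The value operator on bounded measurable payoffs -/

section LowerValue

variable {Ω : Type*} {K : Set (ℝ≥0 → Ω)} [MeasurableSpace K]

/-! The value operator is nonexpansive for the sup norm, so the two dynamic programming principles
with `h = 1` give `‖v (n+1) - w r‖ ≤ |1/(n+1) - r| + (1 - r) ‖v n - w r‖`
(`oneStepComparison_lowerValue`). While `1/i` stays within relative error `ε` of `r`, the excess of
this distance over `ε` shrinks by `1 - r` per step. Such a window has length of order `ε/r`, so
crossing it contracts the excess by some `ρ < 1` independent of `r` (`block_of_pow_le`). If one
family is uniformly close to its limit `U`, windows can be chained at small cost and the distance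
falls to order `ε`. The rest uses only this inequality, not the game. -/

lemma integrable_of_mem_boundedMeasurablePayoffs {c : K → ℝ}
    (hc : c ∈ boundedMeasurablePayoffs K) (Q : ProbabilityMeasure K) :
    Integrable c (Q : Measure K) := by
  obtain ⟨hm, R, hR⟩ := hc
  exact Integrable.of_bound hm.aestronglyMeasurable R (Eventually.of_forall hR)

lemma integral_le_integral_add {c c' : K → ℝ}
    (hc : c ∈ boundedMeasurablePayoffs K) (hc' : c' ∈ boundedMeasurablePayoffs K) {a : ℝ}
    (h : ∀ z, c z ≤ c' z + a) (Q : ProbabilityMeasure K) :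
    ∫ z, c z ∂(Q : Measure K) ≤ ∫ z, c' z ∂(Q : Measure K) + a := by
  have hi := integrable_of_mem_boundedMeasurablePayoffs hc Q
  have hi' := integrable_of_mem_boundedMeasurablePayoffs hc' Q
  calc ∫ z, c z ∂(Q : Measure K) ≤ ∫ z, (c' z + a) ∂(Q : Measure K) :=
        integral_mono hi (hi'.add (integrable_const a)) h
    _ = ∫ z, c' z ∂(Q : Measure K) + a := by
        rw [integral_add hi' (integrable_const a)]; simp

lemma exists_abs_integral_le {c : K → ℝ} (hc : c ∈ boundedMeasurablePayoffs K) :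
    ∃ R : ℝ, ∀ Q : ProbabilityMeasure K, |∫ z, c z ∂(Q : Measure K)| ≤ R := by
  obtain ⟨-, R, hR⟩ := hc
  refine ⟨R, fun Q => ?_⟩
  simpa using norm_integral_le_of_norm_le_const (μ := (Q : Measure K)) (f := c)
    (Eventually.of_forall hR)

variable {L M : Ω → Type*} [∀ ω, Nonempty (L ω)] [∀ ω, Nonempty (M ω)]
  (P : ∀ ω, L ω → M ω → ProbabilityMeasure K)

/-- Monotonicity and translation pass through integral, infimum and supremum. The boundedness facts
are needed because `⨅` and `⨆` in `ℝ` take default values on unbounded families. -/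
lemma lowerValue_le_add {c c' : K → ℝ}
    (hc : c ∈ boundedMeasurablePayoffs K) (hc' : c' ∈ boundedMeasurablePayoffs K) {a : ℝ}
    (h : ∀ z, c z ≤ c' z + a) (ω : Ω) : lowerValue P c ω ≤ lowerValue P c' ω + a := by
  obtain ⟨R, hR⟩ := exists_abs_integral_le hc
  obtain ⟨R', hR'⟩ := exists_abs_integral_le hc'
  have hbelow (l : L ω) : BddBelow (Set.range fun m : M ω => ∫ z, c z ∂(P ω l m : Measure K)) :=
    ⟨-R, by rintro _ ⟨m, rfl⟩; exact (abs_le.1 (hR _)).1⟩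
  have hbelow' (l : L ω) :
      BddBelow (Set.range fun m : M ω => ∫ z, c' z ∂(P ω l m : Measure K)) :=
    ⟨-R', by rintro _ ⟨m, rfl⟩; exact (abs_le.1 (hR' _)).1⟩
  have habove :
      BddAbove (Set.range fun l : L ω => ⨅ m : M ω, ∫ z, c' z ∂(P ω l m : Measure K)) := by
    refine ⟨R', ?_⟩
    rintro _ ⟨l, rfl⟩
    obtain ⟨m⟩ := (inferInstance : Nonempty (M ω))
    exact (ciInf_le (hbelow' l) m).trans (abs_le.1 (hR' _)).2
  refine ciSup_le fun l => ?_
  have hl : (⨅ m : M ω, ∫ z, c z ∂(P ω l m : Measure K)) - a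
      ≤ ⨅ m : M ω, ∫ z, c' z ∂(P ω l m : Measure K) := by
    refine le_ciInf fun m => ?_
    have h1 := ciInf_le (hbelow l) m
    have h2 := integral_le_integral_add hc hc' h (P ω l m)
    linarith
  have := le_ciSup habove l
  change _ ≤ (⨆ l : L ω, ⨅ m : M ω, ∫ z, c' z ∂(P ω l m : Measure K)) + a
  linarith

lemma abs_lowerValue_sub_le {c c' : K → ℝ}
    (hc : c ∈ boundedMeasurablePayoffs K) (hc' : c' ∈ boundedMeasurablePayoffs K) {a : ℝ}
    (h : ∀ z, |c z - c' z| ≤ a) (ω : Ω) : |lowerValue P c ω - lowerValue P c' ω| ≤ a := by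
  rw [abs_sub_le_iff]
  constructor
  · have := lowerValue_le_add P hc hc' (a := a)
      (fun z => by linarith [(abs_sub_le_iff.1 (h z)).1]) ω
    linarith
  · have := lowerValue_le_add P hc' hc (a := a)
      (fun z => by linarith [(abs_sub_le_iff.1 (h z)).2]) ω
    linarith

lemma lowerValue_const (a : ℝ) (ω : Ω) : lowerValue P (fun _ => a) ω = a := by
  simp [lowerValue]

lemma mem_boundedMeasurablePayoffs_of_mem_Icc {c : K → ℝ} (hm : Measurable c)
    (h : ∀ z, c z ∈ Set.Icc (0 : ℝ) 1) : c ∈ boundedMeasurablePayoffs K :=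
  ⟨hm, 1, fun z => abs_le.2 ⟨by linarith [(h z).1], (h z).2⟩⟩

lemma lowerValue_mem_Icc {c : K → ℝ} (hm : Measurable c)
    (h : ∀ z, c z ∈ Set.Icc (0 : ℝ) 1) (ω : Ω) : lowerValue P c ω ∈ Set.Icc (0 : ℝ) 1 := by
  have hc := mem_boundedMeasurablePayoffs_of_mem_Icc hm h
  have h0 : (fun _ : K => (0 : ℝ)) ∈ boundedMeasurablePayoffs K :=
    mem_boundedMeasurablePayoffs_of_mem_Icc measurable_const fun _ => by simp
  have h1 := lowerValue_le_add P h0 hc (a := 0) (fun z => by linarith [(h z).1]) ω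
  have h2 := lowerValue_le_add P hc h0 (a := 1) (fun z => by linarith [(h z).2]) ω
  rw [lowerValue_const] at h1 h2
  constructor <;> linarith

end LowerValue

section Payoffs

variable {Ω : Type*} {K : Set (ℝ≥0 → Ω)} {g : Ω → ℝ}

lemma averagePayoff_mem_Icc (hg : ∀ ω, g ω ∈ Set.Icc (0 : ℝ) 1) {n : ℕ} (hn : 1 ≤ n) (z : K) :
    averagePayoff g n z ∈ Set.Icc (0 : ℝ) 1 := by
  have hn' : (0 : ℝ) < n := by exact_mod_cast hn
  have h0 : 0 ≤ ∑ t ∈ Finset.range n, g (z.1 (t : ℝ≥0)) :=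
    Finset.sum_nonneg fun t _ => (hg _).1
  have h1 : ∑ t ∈ Finset.range n, g (z.1 (t : ℝ≥0)) ≤ n := by
    simpa using Finset.sum_le_sum fun t (_ : t ∈ Finset.range n) => (hg (z.1 (t : ℝ≥0))).2
  unfold averagePayoff
  refine ⟨by positivity, ?_⟩
  rw [one_div_mul_eq_div, div_le_one hn']
  exact h1

lemma discountedPayoff_mem_Icc (hg : ∀ ω, g ω ∈ Set.Icc (0 : ℝ) 1) {μ : ℝ} (h0 : 0 < μ)
    (h1 : μ < 1) (z : K) : discountedPayoff g μ z ∈ Set.Icc (0 : ℝ) 1 := by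
  have hr : 0 ≤ 1 - μ := by linarith
  have hs : HasSum (fun t : ℕ => (1 - μ) ^ t) μ⁻¹ := by
    simpa using hasSum_geometric_of_lt_one hr (by linarith)
  have hnn (t : ℕ) : 0 ≤ (1 - μ) ^ t * g (z.1 (t : ℝ≥0)) :=
    mul_nonneg (pow_nonneg hr t) (hg _).1
  have hle (t : ℕ) : (1 - μ) ^ t * g (z.1 (t : ℝ≥0)) ≤ (1 - μ) ^ t :=
    mul_le_of_le_one_right (pow_nonneg hr t) (hg _).2
  have hsum := (Summable.of_nonneg_of_le hnn hle hs.summable).tsum_le_tsum hle hs.summable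
  rw [hs.tsum_eq] at hsum
  refine ⟨mul_nonneg h0.le (tsum_nonneg hnn), ?_⟩
  calc μ * ∑' t : ℕ, (1 - μ) ^ t * g (z.1 (t : ℝ≥0)) ≤ μ * μ⁻¹ :=
        mul_le_mul_of_nonneg_left hsum h0.le
    _ = 1 := mul_inv_cancel₀ h0.ne'

end Payoffs

/-! ### Tauberian argument from the one-step inequality -/

section Tauberian

variable {Ω : Type*}

lemma one_sub_pow_le_exp {r : ℝ} (h1 : r < 1) {k : ℕ} {s : ℝ}
    (h : s ≤ r * k) : (1 - r) ^ k ≤ Real.exp (-s) := by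
  calc (1 - r) ^ k ≤ Real.exp (-r) ^ k :=
        pow_le_pow_left₀ (by linarith) (Real.one_sub_le_exp_neg r) k
    _ = Real.exp (k * -r) := (Real.exp_nat_mul _ _).symm
    _ ≤ Real.exp (-s) := Real.exp_le_exp.2 (by linarith)

/-- The one-step comparison between a sequence `v` and a family `w` of functions which are the
values of finite-horizon and of discounted problems with a common one-step operator. -/
structure OneStepComparison (v : ℕ → Ω → ℝ) (w : ℝ → Ω → ℝ) : Prop where
  abs_sub_le_one : ∀ n : ℕ, 1 ≤ n → ∀ r : ℝ, 0 < r → r < 1 → ∀ ω, |v n ω - w r ω| ≤ 1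
  step : ∀ n : ℕ, 1 ≤ n → ∀ r : ℝ, 0 < r → r < 1 → ∀ a : ℝ, (∀ ω, |v n ω - w r ω| ≤ a) →
    ∀ ω, |v (n + 1) ω - w r ω| ≤ |1 / ((n : ℝ) + 1) - r| + (1 - r) * a

namespace OneStepComparison

variable {v : ℕ → Ω → ℝ} {w : ℝ → Ω → ℝ}

/-- `ε` is the fixed point of `x ↦ ε * r + (1 - r) * x`, so only the excess `X` is multiplied by `1
- r` at each step. -/
lemma block (H : OneStepComparison v w) {n k : ℕ} (hn : 1 ≤ n)
    {r : ℝ} (h0 : 0 < r) (h1 : r < 1) {ε X : ℝ}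
    (hε : ∀ i : ℕ, n < i → i ≤ n + k → |1 / (i : ℝ) - r| ≤ ε * r)
    (hX : ∀ ω, |v n ω - w r ω| ≤ ε + X) :
    ∀ ω, |v (n + k) ω - w r ω| ≤ ε + (1 - r) ^ k * X := by
  induction k with
  | zero => simpa using hX
  | succ k ih =>
    intro ω
    have h2 := H.step (n + k) (by omega) r h0 h1 _
      (ih fun i hi hi' => hε i hi (by omega)) ω
    have h3 := hε (n + k + 1) (by omega) (by omega)
    push_cast at h2 h3
    calc |v (n + (k + 1)) ω - w r ω|
        ≤ ε * r + (1 - r) * (ε + (1 - r) ^ k * X) := h2.trans (by linarith)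
      _ = ε + (1 - r) ^ (k + 1) * X := by ring

/-- A block of `k` steps contracts the distance by `ρ` as soon as `(1 - r) ^ k ≤ ρ`. -/
lemma block_of_pow_le (H : OneStepComparison v w) {n k : ℕ} (hn : 1 ≤ n)
    {r : ℝ} (h0 : 0 < r) (h1 : r < 1) {ε X ρ : ℝ}
    (hε : ∀ i : ℕ, n < i → i ≤ n + k → |1 / (i : ℝ) - r| ≤ ε * r)
    (hρ : (1 - r) ^ k ≤ ρ) (h_nonneg : 0 ≤ X)
    (hX : ∀ ω, |v n ω - w r ω| ≤ ε + X) (ω : Ω) :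
    |v (n + k) ω - w r ω| ≤ ε + ρ * X :=
  (H.block hn h0 h1 hε hX ω).trans (by gcongr)

/-- The window ends at `m`, with `r = 1/m`, and starts near `m/(1+ε)`. Each further window changes
`r`, which is harmless since both `w r` are near `U`. -/
lemma tendstoUniformly_average (H : OneStepComparison v w) {U : Ω → ℝ}
    (hU : TendstoUniformly w U (𝓝[Set.Ioo 0 1] 0)) : TendstoUniformly v U atTop := by
  rw [Metric.tendstoUniformly_iff] at hU ⊢
  intro η hη
  obtain ⟨ε, hε0, hεη⟩ : ∃ ε : ℝ, 0 < ε ∧ 3 * ε < η := ⟨η / 4, by positivity, by linarith⟩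
  set s : ℝ := ε / (1 + ε) with hs
  have hs0 : 0 < s := by positivity
  set ρ : ℝ := Real.exp (-s) with hρ
  have hρ0 : 0 < ρ := Real.exp_pos _
  have hρ1 : ρ < 1 := by rw [hρ, Real.exp_lt_one_iff]; linarith
  -- Passing between `w r` and `U` at both ends of a window costs at most `2 * δ = ε - ρ * ε`,
  -- exactly what keeps the second `ε` in `key` invariant.
  set δ : ℝ := (1 - ρ) * ε / 2 with hδ
  have hδ0 : 0 < δ := by
    have : 0 < 1 - ρ := by linarith
    positivity
  have hδε : δ ≤ ε := by nlinarith
  have hinv : Tendsto (fun n : ℕ => 1 / (n : ℝ)) atTop (𝓝[Set.Ioo 0 1] 0) := by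
    refine tendsto_nhdsWithin_iff.2 ⟨tendsto_one_div_atTop_nhds_zero_nat, ?_⟩
    filter_upwards [eventually_ge_atTop 2] with n hn
    have : (2 : ℝ) ≤ n := by exact_mod_cast hn
    exact ⟨by positivity, by rw [div_lt_one (by linarith)]; linarith⟩
  have hwU : ∀ᶠ n : ℕ in atTop, ∀ ω, |w (1 / (n : ℝ)) ω - U ω| ≤ δ := by
    filter_upwards [hinv.eventually (hU δ hδ0)] with n hn ω
    have := hn ω
    rw [dist_comm, Real.dist_eq] at this
    exact this.le
  have key (j : ℕ) : ∀ᶠ n : ℕ in atTop, ∀ ω, |v n ω - U ω| ≤ ε + (ε + ρ ^ j) := by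
    induction j with
    | zero =>
      filter_upwards [hwU, eventually_ge_atTop 2] with n hn hn2 ω
      have h2 : (2 : ℝ) ≤ n := by exact_mod_cast hn2
      have := H.abs_sub_le_one n (by omega) (1 / (n : ℝ)) (by positivity)
        (by rw [div_lt_one (by linarith)]; linarith) ω
      have := abs_sub_le (v n ω) (w (1 / (n : ℝ)) ω) (U ω)
      have := hn ω
      simp only [pow_zero]
      linarith
    | succ j ih =>
      have hfl : Tendsto (fun m : ℕ => ⌊(m : ℝ) / (1 + ε)⌋₊) atTop atTop :=
        tendsto_nat_floor_atTop.comp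
          (tendsto_natCast_atTop_atTop.atTop_div_const (by positivity))
      filter_upwards [hwU, eventually_ge_atTop 2, hfl.eventually ih,
        hfl.eventually (eventually_ge_atTop 1)] with m hm hm2 hvn hn1
      set n := ⌊(m : ℝ) / (1 + ε)⌋₊
      have h2 : (2 : ℝ) ≤ m := by exact_mod_cast hm2
      have hm0 : (0 : ℝ) < m := by linarith
      have hle : (n : ℝ) ≤ m / (1 + ε) := Nat.floor_le (by positivity)
      have hlt : (m : ℝ) / (1 + ε) < n + 1 := Nat.lt_floor_add_one _
      have hnm : n ≤ m := by
        have : (m : ℝ) / (1 + ε) ≤ m := div_le_self hm0.le (by linarith)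
        exact_mod_cast hle.trans this
      obtain ⟨k, hk⟩ := Nat.exists_eq_add_of_le hnm
      have hr0 : 0 < 1 / (m : ℝ) := by positivity
      have hr1 : 1 / (m : ℝ) < 1 := by rw [div_lt_one hm0]; linarith
      have hblock (i : ℕ) (hi : n < i) (hi' : i ≤ m) :
          |1 / (i : ℝ) - 1 / m| ≤ ε * (1 / m) := by
        have hi0 : (0 : ℝ) < i := by exact_mod_cast (by omega : 0 < i)
        have hni : (n : ℝ) + 1 ≤ i := by exact_mod_cast hi
        have him : (i : ℝ) ≤ m := by exact_mod_cast hi'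
        have hge : 1 / (m : ℝ) ≤ 1 / i := one_div_le_one_div_of_le hi0 him
        have hle' : 1 / (i : ℝ) ≤ (1 + ε) * (1 / m) := by
          rw [mul_one_div, div_le_div_iff₀ hi0 hm0]
          rw [div_lt_iff₀ (by positivity)] at hlt
          nlinarith
        rw [abs_of_nonneg (by linarith)]
        linarith
      -- Here `k = m - n ≥ m * ε / (1 + ε) = s * m`.
      have hpow : (1 - 1 / (m : ℝ)) ^ k ≤ ρ := by
        refine one_sub_pow_le_exp hr1 ?_
        have hk' : (k : ℝ) = m - n := by rw [hk]; push_cast; ring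
        rw [hk', one_div_mul_eq_div, hs, div_le_div_iff₀ (by positivity) hm0]
        rw [le_div_iff₀ (by positivity)] at hle
        nlinarith
      have hstart (ω : Ω) : |v n ω - w (1 / (m : ℝ)) ω| ≤ ε + (ε + ρ ^ j + δ) := by
        have h3 := abs_sub_le (v n ω) (U ω) (w (1 / (m : ℝ)) ω)
        rw [abs_sub_comm (U ω)] at h3
        linarith [hvn ω, hm ω]
      intro ω
      have h4 := H.block_of_pow_le hn1 hr0 hr1 (fun i hi hi' => hblock i hi (by omega)) hpow
        (by positivity) hstart ω
      rw [← hk] at h4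
      have h5 := abs_sub_le (v m ω) (w (1 / (m : ℝ)) ω) (U ω)
      have h6 := hm ω
      have h7 : ρ * δ ≤ δ := mul_le_of_le_one_left hδ0.le hρ1.le
      have h8 : ρ * (ε + ρ ^ j + δ) = ρ * ε + ρ ^ (j + 1) + ρ * δ := by ring
      have h9 : 2 * δ = ε - ρ * ε := by rw [hδ]; ring
      linarith
  obtain ⟨j, hj⟩ := exists_pow_lt_of_lt_one hε0 hρ1
  filter_upwards [key j] with n hn ω
  rw [dist_comm, Real.dist_eq]
  linarith [hn ω]

/-- Here `r` and the window from `n` to `n + k` are fixed. As `v n` and `v (n + k)` are both near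
`U`, the contracted bound at `n + k` returns to `n`, and the argument repeats. -/
lemma tendstoUniformly_discounted (H : OneStepComparison v w) {U : Ω → ℝ}
    (hU : TendstoUniformly v U atTop) : TendstoUniformly w U (𝓝[Set.Ioo 0 1] 0) := by
  rw [Metric.tendstoUniformly_iff] at hU ⊢
  intro η hη
  obtain ⟨ε, hε0, hεη⟩ : ∃ ε : ℝ, 0 < ε ∧ 4 * ε < η := ⟨η / 5, by positivity, by linarith⟩
  set ρ : ℝ := Real.exp (-(ε / 2)) with hρ
  have hρ0 : 0 < ρ := Real.exp_pos _
  have hρ1 : ρ < 1 := by rw [hρ, Real.exp_lt_one_iff]; linarith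
  set δ : ℝ := (1 - ρ) * ε / 2 with hδ
  have hδ0 : 0 < δ := by
    have : 0 < 1 - ρ := by linarith
    positivity
  have hδε : δ ≤ ε := by nlinarith
  obtain ⟨N, hN⟩ := eventually_atTop.1 (hU δ hδ0)
  have hvU (n : ℕ) (hn : N ≤ n) (ω : Ω) : |v n ω - U ω| ≤ δ := by
    have := hN n hn ω
    rw [dist_comm, Real.dist_eq] at this
    exact this.le
  have hfl : Tendsto (fun r : ℝ => ⌊r⁻¹⌋₊) (𝓝[Set.Ioo 0 1] 0) atTop :=
    tendsto_nat_floor_atTop.comp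
      (tendsto_inv_nhdsGT_zero.mono_left (nhdsWithin_mono _ fun x hx => hx.1))
  filter_upwards [self_mem_nhdsWithin, hfl.eventually (eventually_ge_atTop (max 1 N)),
    hfl.eventually (eventually_ge_atTop ⌈(2 + ε) / ε⌉₊)] with r hr hnN hn_large
  obtain ⟨hr0, hr1⟩ := hr
  set n := ⌊r⁻¹⌋₊
  have hle : (n : ℝ) ≤ r⁻¹ := Nat.floor_le (by positivity)
  have hlt : r⁻¹ < n + 1 := Nat.lt_floor_add_one _
  have hrn : r * n ≤ 1 := by
    calc r * n ≤ r * r⁻¹ := by gcongr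
      _ = 1 := mul_inv_cancel₀ hr0.ne'
  have hrn' : 1 < r * (n + 1) := by
    calc 1 = r * r⁻¹ := (mul_inv_cancel₀ hr0.ne').symm
      _ < r * (n + 1) := by gcongr
  -- Large enough that, despite the floor, `k ≥ ε * n - 1 ≥ (ε / 2) * (n + 1)`, hence `r * k ≥ ε /
  -- 2`.
  have hn_eps : 2 + ε ≤ ε * n := by
    have : (2 + ε) / ε ≤ n := Nat.ceil_le.1 hn_large
    rwa [div_le_iff₀ hε0, mul_comm] at this
  set k := ⌊ε * n⌋₊
  have hk_le : (k : ℝ) ≤ ε * n := Nat.floor_le (by positivity)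
  have hk_lt : ε * n < k + 1 := Nat.lt_floor_add_one _
  have hblock (i : ℕ) (hi : n < i) (hi' : i ≤ n + k) : |1 / (i : ℝ) - r| ≤ ε * r := by
    have hi0 : (0 : ℝ) < i := by exact_mod_cast (by omega : 0 < i)
    have hni : (n : ℝ) + 1 ≤ i := by exact_mod_cast hi
    have hik : (i : ℝ) ≤ n + k := by exact_mod_cast hi'
    have hub : 1 / (i : ℝ) ≤ r := by
      rw [div_le_iff₀ hi0]
      nlinarith
    have hlb : r - ε * r ≤ 1 / (i : ℝ) := by
      rw [le_div_iff₀ hi0]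
      have hri : r * i ≤ 1 + ε := by nlinarith
      have hri' : 1 ≤ r * i := by nlinarith
      nlinarith
    rw [abs_sub_comm, abs_of_nonneg (by linarith)]
    linarith
  have hpow : (1 - r) ^ k ≤ ρ := by
    refine one_sub_pow_le_exp hr1 ?_
    have h1 : (ε / 2) * (n + 1) ≤ k := by linarith
    nlinarith
  have hn1 : 1 ≤ n := (le_max_left _ _).trans hnN
  have hnN' : N ≤ n := (le_max_right _ _).trans hnN
  have key (j : ℕ) : ∀ ω, |v n ω - w r ω| ≤ ε + (ε + ρ ^ j) := by
    induction j with
    | zero =>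
      intro ω
      have := H.abs_sub_le_one n hn1 r hr0 hr1 ω
      simp only [pow_zero]
      linarith
    | succ j ih =>
      intro ω
      have h4 := H.block_of_pow_le hn1 hr0 hr1 hblock hpow (by positivity) ih ω
      have h5 := abs_sub_le (v n ω) (v (n + k) ω) (w r ω)
      have h6 := abs_sub_le (v n ω) (U ω) (v (n + k) ω)
      rw [abs_sub_comm (U ω)] at h6
      have h7 := hvU n hnN' ω
      have h8 := hvU (n + k) (by omega) ω
      have h9 : ρ * (ε + ρ ^ j) = ρ * ε + ρ ^ (j + 1) := by ring
      have h10 : 2 * δ = ε - ρ * ε := by rw [hδ]; ring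
      linarith
  obtain ⟨j, hj⟩ := exists_pow_lt_of_lt_one hε0 hρ1
  intro ω
  rw [Real.dist_eq]
  have h1 := abs_sub_le (U ω) (v n ω) (w r ω)
  rw [abs_sub_comm (U ω) (v n ω)] at h1
  linarith [hvU n hnN' ω, key j ω]

end OneStepComparison

end Tauberian

lemma oneStepComparison_lowerValue {Ω : Type*} {K : Set (ℝ≥0 → Ω)} [MeasurableSpace K]
    {g : Ω → ℝ} (hg : ∀ ω, g ω ∈ Set.Icc (0 : ℝ) 1)
    {L M : Ω → Type*} [∀ ω, Nonempty (L ω)] [∀ ω, Nonempty (M ω)]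
    (P : ∀ ω, L ω → M ω → ProbabilityMeasure K)
    (hv : ∀ n : ℕ, 1 ≤ n → Measurable (averagePayoff g n : K → ℝ))
    (hw : ∀ μ : ℝ, 0 < μ → μ < 1 → Measurable (discountedPayoff g μ : K → ℝ))
    (hvDPP : AverageDPP g (boundedMeasurablePayoffs K) (lowerValue P))
    (hwDPP : DiscountedDPP g (boundedMeasurablePayoffs K) (lowerValue P)) :
    OneStepComparison (fun n => lowerValue P (averagePayoff g n))
      (fun μ => lowerValue P (discountedPayoff g μ)) where
  abs_sub_le_one n hn r h0 h1 ω := by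
    have hV := lowerValue_mem_Icc P (hv n hn) (averagePayoff_mem_Icc hg hn) ω
    have hW := lowerValue_mem_Icc P (hw r h0 h1) (discountedPayoff_mem_Icc hg h0 h1) ω
    rw [abs_sub_le_iff]
    constructor <;> linarith [hV.1, hV.2, hW.1, hW.2]
  step n hn r h0 h1 a ha ω := by
    obtain ⟨hc, hVc⟩ := hvDPP n 1 hn le_rfl
    obtain ⟨hc', hWc⟩ := hwDPP r h0 h1 1 le_rfl
    rw [← hVc, ← hWc]
    refine abs_lowerValue_sub_le P hc hc' (fun z => ?_) ω
    have hn0 : (0 : ℝ) < (n : ℝ) + 1 := by positivity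
    set x := g (z.1 0)
    set y := lowerValue P (averagePayoff g n : K → ℝ) (z.1 ((1 : ℕ) : ℝ≥0))
    set y' := lowerValue P (discountedPayoff g r : K → ℝ) (z.1 ((1 : ℕ) : ℝ≥0))
    have hx : x ∈ Set.Icc (0 : ℝ) 1 := hg _
    have hyI : y ∈ Set.Icc (0 : ℝ) 1 :=
      lowerValue_mem_Icc P (hv n hn) (averagePayoff_mem_Icc hg hn) _
    have hxy : |x - y| ≤ 1 := by
      rw [abs_sub_le_iff]
      constructor <;> linarith [hx.1, hx.2, hyI.1, hyI.2]
    have hyy : |y - y'| ≤ a := ha _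
    have hfrac : (n : ℝ) / (n + 1) = 1 - 1 / ((n : ℝ) + 1) := by field_simp; simp
    simp only [Finset.sum_range_one, Nat.cast_one, Nat.cast_zero, pow_zero, pow_one, one_mul]
    -- Grouping by `x - y` charges the change of weight only once, since `x` and `y` both lie in
    -- `[0, 1]`.
    calc |1 / ((n : ℝ) + 1) * x + n / (n + 1) * y - (r * x + (1 - r) * y')|
        = |(1 / ((n : ℝ) + 1) - r) * (x - y) + (1 - r) * (y - y')| := by
          rw [hfrac]; congr 1; ring
      _ ≤ |1 / ((n : ℝ) + 1) - r| * |x - y| + (1 - r) * |y - y'| := by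
          refine (abs_add_le _ _).trans_eq ?_
          rw [abs_mul, abs_mul, abs_of_pos (by linarith : 0 < 1 - r)]
      _ ≤ |1 / ((n : ℝ) + 1) - r| + (1 - r) * a := by
          gcongr
          exact mul_le_of_le_one_right (abs_nonneg _) hxy

end TauberianGame

theorem corollary2 {Ω : Type*} [Nonempty Ω] (K : Set (ℝ≥0 → Ω)) [MeasurableSpace K]
    (hK : TauberianGame.IsDiscreteTime K)
    (g : Ω → ℝ) (hg : ∀ ω, g ω ∈ Set.Icc (0 : ℝ) 1)
    (L M : Ω → Type*) [∀ ω, Nonempty (L ω)] [∀ ω, Nonempty (M ω)]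
    (P : ∀ ω, L ω → M ω → ProbabilityMeasure K)
    (hv : ∀ n : ℕ, 1 ≤ n → Measurable (TauberianGame.averagePayoff g n : K → ℝ))
    (hw : ∀ μ : ℝ, 0 < μ → μ < 1 → Measurable (TauberianGame.discountedPayoff g μ : K → ℝ))
    (hvDPP : TauberianGame.AverageDPP g (TauberianGame.boundedMeasurablePayoffs K)
      (TauberianGame.lowerValue P))
    (hwDPP : TauberianGame.DiscountedDPP g (TauberianGame.boundedMeasurablePayoffs K)
      (TauberianGame.lowerValue P)) :
    ((∃ U : Ω → ℝ, TendstoUniformly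
        (fun (n : ℕ) ω => TauberianGame.lowerValue P (TauberianGame.averagePayoff g n) ω)
        U atTop) ↔
      (∃ U : Ω → ℝ, TendstoUniformly
        (fun (μ : ℝ) ω => TauberianGame.lowerValue P (TauberianGame.discountedPayoff g μ) ω)
        U (𝓝[Set.Ioo 0 1] 0))) ∧
    (((∃ U : Ω → ℝ, TendstoUniformly
        (fun (n : ℕ) ω => TauberianGame.lowerValue P (TauberianGame.averagePayoff g n) ω)
        U atTop) ∨
      (∃ U : Ω → ℝ, TendstoUniformly
        (fun (μ : ℝ) ω => TauberianGame.lowerValue P (TauberianGame.discountedPayoff g μ) ω)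
        U (𝓝[Set.Ioo 0 1] 0))) →
      ∀ ω : Ω, ∃ a : ℝ,
        Tendsto (fun n : ℕ => TauberianGame.lowerValue P (TauberianGame.averagePayoff g n) ω)
          atTop (𝓝 a) ∧
        Tendsto (fun μ : ℝ => TauberianGame.lowerValue P (TauberianGame.discountedPayoff g μ) ω)
          (𝓝[Set.Ioo 0 1] 0) (𝓝 a)) := by
  have H := TauberianGame.oneStepComparison_lowerValue hg P hv hw hvDPP hwDPP
  refine ⟨⟨fun ⟨U, hU⟩ => ⟨U, H.tendstoUniformly_discounted hU⟩,
    fun ⟨U, hU⟩ => ⟨U, H.tendstoUniformly_average hU⟩⟩, ?_⟩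
  rintro (⟨U, hU⟩ | ⟨U, hU⟩) ω
  · exact ⟨U ω, hU.tendsto_at ω, (H.tendstoUniformly_discounted hU).tendsto_at ω⟩
  · exact ⟨U ω, (H.tendstoUniformly_average hU).tendsto_at ω, hU.tendsto_at ω⟩
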